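/- All graphs are finite and simple, and $\rho(G)$ denotes the spectral radius of $G$, i.e. the largest eigenvalue of its adjacency matrix. For $n>k>0$ let $S_{n,k}^0=K_k\nabla (n-k)K_1$ be the graph of order $n$ obtained from a complete graph on $k$ vertices and an independent set of $n-k$ vertices by joining every vertex of the former to every vertex of the latter. A spider is a tree of order at least $4$ with at most one vertex of degree at least $3$; its center is the vertex of degree at least $3$ (if there is none, any vertex of degree $2$ may be taken as the center). A leg of a spider is a path from the center to a leaf, and its length is its number of edges. Let $k\ge 2$ and let $F$ be a spider of order $2k+3$ with exactly $r$ legs of odd length and exactly $s$ legs of length $1$ (the latter being counted among the former). If $r\ge 3$ and $2s-r\ge 2$, then there is an integer $N$ such that for every $n\ge N$, every graph $G$ of order $n$ with $\rho(G)\ge\rho(S_{n,k}^0)$ contains $F$ as a (not necessarily induced) subgraph. -/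

import Mathlib

namespace SpiderSpectral

open Classical in
/-- The spectral radius `ρ(G)` of a finite graph: the largest eigenvalue of its (real symmetric)
adjacency matrix. For a nonempty vertex set the spectrum is finite and nonempty, so that this
supremum is a maximum. -/
noncomputable def rho {V : Type*} [Fintype V] (G : SimpleGraph V) : ℝ :=
  sSup (spectrum ℝ (G.adjMatrix ℝ))

/-- The join `G ∇ H` of two graphs: their disjoint union together with all edges between them. -/
def join {V W : Type*} (G : SimpleGraph V) (H : SimpleGraph W) : SimpleGraph (V ⊕ W) :=
  G.sum H ⊔ completeBipartiteGraph V W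

/-- The graph `S_{n,k}^0 = K_k ∇ (n-k)K_1`, of order `n` when `k ≤ n`. -/
def splitGraph (n k : ℕ) : SimpleGraph (Fin k ⊕ Fin (n - k)) :=
  join (⊤ : SimpleGraph (Fin k)) (⊥ : SimpleGraph (Fin (n - k)))

/-- A spider: a tree of order at least 4 with at most one vertex of degree at least 3. -/
structure IsSpider {W : Type*} [Fintype W] (F : SimpleGraph W) [DecidableRel F.Adj] : Prop where
  isTree : F.IsTree
  four_le_card : 4 ≤ Fintype.card W
  branch_unique : ∀ u v : W, 3 ≤ F.degree u → 3 ≤ F.degree v → u = v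

/-- `c` is a center of the spider `F`: the vertex of degree at least 3 if there is one, and
any vertex of degree 2 otherwise. -/
def IsCenter {W : Type*} [Fintype W] (F : SimpleGraph W) [DecidableRel F.Adj] (c : W) : Prop :=
  3 ≤ F.degree c ∨ ((∀ v : W, F.degree v ≤ 2) ∧ F.degree c = 2)

/-- The legs of `F` with respect to the center `c`: the paths from `c` to a leaf,
recorded together with that leaf. -/
def legs {W : Type*} [Fintype W] (F : SimpleGraph W) [DecidableRel F.Adj] (c : W) :
    Set (Σ v : W, F.Path c v) :=
  {p | F.degree p.1 = 1}

/-- The number of legs of odd length. -/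
noncomputable def numOddLegs {W : Type*} [Fintype W] (F : SimpleGraph W) [DecidableRel F.Adj]
    (c : W) : ℕ :=
  {p ∈ legs F c | Odd (p.2 : F.Walk c p.1).length}.ncard

/-- The number of legs of length 1. -/
noncomputable def numUnitLegs {W : Type*} [Fintype W] (F : SimpleGraph W) [DecidableRel F.Adj]
    (c : W) : ℕ :=
  {p ∈ legs F c | (p.2 : F.Walk c p.1).length = 1}.ncard

end SpiderSpectral

/-!
Suppose that a tree `F` is contained in `K_{k,t}` and that `G` is an `F`-free graph of order `n`.
Then `G` has no subgraph of large minimum degree, so it has an orientation with bounded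
outdegrees. In particular, for every `e > 0` only boundedly many vertices have degree above
`e ^ 2 * n`, and since `G` contains no `K_{k,t}`, only boundedly many vertices are adjacent to `k`
of these. Up to a subgraph on this bounded set, `G` is the union of a bipartite graph in which one
side has degrees at most `k - 1`, with spectral radius at most `√((k - 1) * n)`, and of a graph of
maximum degree `e ^ 2 * n` and bounded outdegrees, with spectral radius `O(e * √n)`; both bounds
are instances of Schur's test. Thus `ρ(G) ≤ O(1) + β * √n` with `β < √k`, whereas
`ρ(K_k ∇ (n-k)K_1) ≥ √(k * (n - k))`.

For a spider, counting the edges at the vertices at odd distance from the center shows that at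
most `k` vertices are at even distance, whence the embedding into `K_{k,t}`.
-/

namespace SpiderSpectral

open Finset Matrix SimpleGraph

variable {V W : Type*} {F : SimpleGraph W} {G H K : SimpleGraph V}

section SpectralRadius

variable [Fintype V] [Fintype W]

open Classical in
/-- The quadratic form `x ↦ xᵀ A x` of the adjacency matrix `A` of `G`, through which `rho G` is
estimated by Rayleigh quotients. -/
noncomputable def adjForm (G : SimpleGraph V) (x : V → ℝ) : ℝ :=
  x ⬝ᵥ G.adjMatrix ℝ *ᵥ x

open Classical in
lemma adjForm_eq_sum (G : SimpleGraph V) (x : V → ℝ) :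
    adjForm G x = ∑ u, ∑ v, if G.Adj u v then x u * x v else 0 :=
  dotProduct_mulVec_adjMatrix x x

lemma adjForm_le_rho_mul (G : SimpleGraph V) (x : V → ℝ) :
    adjForm G x ≤ rho G * (x ⬝ᵥ x) := by
  classical
  have hpsd : (algebraMap ℝ (Matrix V V ℝ) (rho G) - G.adjMatrix ℝ).PosSemidef := by
    refine posSemidef_iff_isHermitian_and_spectrum_nonneg.2 ⟨?_, ?_⟩
    · simp [IsHermitian, algebraMap_eq_diagonal]
    · rw [← spectrum.singleton_sub_eq]
      rintro _ ⟨_, rfl, μ, hμ, rfl⟩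
      refine sub_nonneg.2 (le_csSup (Matrix.finite_spectrum (G.adjMatrix ℝ)).bddAbove ?_)
      convert hμ
  have hnonneg := (posSemidef_iff_dotProduct_mulVec.1 hpsd).2 x
  rw [star_trivial, sub_mulVec, dotProduct_sub, Algebra.algebraMap_eq_smul_one, smul_mulVec,
    one_mulVec, dotProduct_smul, smul_eq_mul] at hnonneg
  unfold adjForm
  convert sub_nonneg.1 hnonneg

lemma adjForm_le_adjForm_abs (G : SimpleGraph V) (x : V → ℝ) : adjForm G x ≤ adjForm G |x| := by
  simp only [adjForm_eq_sum, Pi.abs_apply, ← abs_mul]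
  gcongr with u _ v _
  split_ifs
  exacts [le_abs_self _, le_rfl]

lemma rho_le_of_forall_nonneg_adjForm_le [Nonempty V] {B : ℝ}
    (h : ∀ x : V → ℝ, 0 ≤ x → adjForm G x ≤ B * (x ⬝ᵥ x)) : rho G ≤ B := by
  classical
  obtain ⟨v⟩ := ‹Nonempty V›
  have hB : 0 ≤ B := by
    simpa [adjForm] using h (Pi.single v 1) (Pi.single_nonneg.2 zero_le_one)
  refine Real.sSup_le (fun μ hμ => ?_) hB
  rw [← spectrum_toLin', ← Module.End.hasEigenvalue_iff_mem_spectrum] at hμ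
  obtain ⟨x, hx⟩ := hμ.exists_hasEigenvector
  have hpos : 0 < x ⬝ᵥ x := by simpa using dotProduct_self_star_pos_iff.2 hx.2
  refine le_of_mul_le_mul_right ?_ hpos
  calc μ * (x ⬝ᵥ x) = adjForm G x := by
        rw [adjForm, ← toLin'_apply, hx.apply_eq_smul, dotProduct_smul, smul_eq_mul]
    _ ≤ adjForm G |x| := adjForm_le_adjForm_abs G x
    _ ≤ B * (|x| ⬝ᵥ |x|) := h |x| (abs_nonneg x)
    _ = B * (x ⬝ᵥ x) := by simp [dotProduct]

lemma rho_le_add_of_le_sup [Nonempty V] (h : G ≤ H ⊔ K) : rho G ≤ rho H + rho K := by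
  refine rho_le_of_forall_nonneg_adjForm_le fun x hx => ?_
  calc adjForm G x ≤ adjForm H x + adjForm K x := by
        simp only [adjForm_eq_sum, ← sum_add_distrib]
        gcongr with u _ v _
        have hxx : 0 ≤ x u * x v := mul_nonneg (hx u) (hx v)
        have huv : G.Adj u v → H.Adj u v ∨ K.Adj u v := @h u v
        split_ifs <;> first | tauto | linarith
    _ ≤ rho H * (x ⬝ᵥ x) + rho K * (x ⬝ᵥ x) :=
        add_le_add (adjForm_le_rho_mul H x) (adjForm_le_rho_mul K x)
    _ = (rho H + rho K) * (x ⬝ᵥ x) := (add_mul _ _ _).symm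

lemma sqrt_card_mul_card_le_rho_join [Nonempty V] [Nonempty W] (G : SimpleGraph V)
    (H : SimpleGraph W) : √(Fintype.card V * Fintype.card W) ≤ rho (join G H) := by
  set p : ℝ := (Fintype.card V : ℝ) with hp
  set q : ℝ := (Fintype.card W : ℝ) with hq
  have hp0 : 0 < p := Nat.cast_pos.2 Fintype.card_pos
  have hq0 : 0 < q := Nat.cast_pos.2 Fintype.card_pos
  let x : V ⊕ W → ℝ := Sum.elim (fun _ => √q) (fun _ => √p)
  have hnorm : x ⬝ᵥ x = 2 * (p * q) := by
    simp [x, dotProduct, ← hp, ← hq, hp0.le, hq0.le]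
    ring
  have hform : 2 * (p * q) * √(p * q) ≤ adjForm (join G H) x := by
    classical
    have hG : 0 ≤ ∑ u, ∑ v, if G.Adj u v then √q * √q else 0 := by positivity
    have hH : 0 ≤ ∑ u, ∑ v, if H.Adj u v then √p * √p else 0 := by positivity
    have hcross : √(p * q) = √p * √q := Real.sqrt_mul hp0.le q
    calc 2 * (p * q) * √(p * q) = q * (p * (√p * √q)) + p * (q * (√q * √p)) := by
          rw [hcross]; ring
      _ ≤ (∑ u, ∑ v, if G.Adj u v then √q * √q else 0) + q * (p * (√p * √q)) +
          (p * (q * (√q * √p)) + ∑ u, ∑ v, if H.Adj u v then √p * √p else 0) := by linarith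
      _ = adjForm (join G H) x := by
          simp [adjForm_eq_sum, sum_add_distrib, join, x, p, q, -Real.mul_self_sqrt]
  have := hform.trans (adjForm_le_rho_mul _ x)
  rw [hnorm, mul_comm (rho _)] at this
  exact le_of_mul_le_mul_left this (by positivity)

lemma sqrt_mul_le_rho_splitGraph {n k : ℕ} (hk : 0 < k) (hn : k < n) :
    √(k * (n - k)) ≤ rho (splitGraph n k) := by
  have : NeZero k := ⟨hk.ne'⟩
  have : NeZero (n - k) := ⟨(Nat.sub_pos_of_lt hn).ne'⟩
  have h := sqrt_card_mul_card_le_rho_join (⊤ : SimpleGraph (Fin k)) (⊥ : SimpleGraph (Fin (n - k)))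
  rwa [Fintype.card_fin, Fintype.card_fin, Nat.cast_sub hn.le] at h

lemma rho_le_of_weights [Nonempty V] [DecidableRel G.Adj] {w : V → V → ℝ} {B : ℝ}
    (hw₀ : ∀ u v, 0 ≤ w u v) (hw : ∀ u v, G.Adj u v → 1 ≤ w u v * w v u)
    (hB : ∀ u, ∑ v ∈ G.neighborFinset u, w u v ≤ B) : rho G ≤ B := by
  refine rho_le_of_forall_nonneg_adjForm_le fun x _ => ?_
  have hamgm (u v : V) (huv : G.Adj u v) :
      x u * x v ≤ (w u v * x u ^ 2 + w v u * x v ^ 2) / 2 := by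
    have hpos : 0 < w u v := (hw₀ u v).lt_of_ne fun h => by
      simpa [← h, zero_lt_one.not_ge] using hw u v huv
    have hsq : w u v * x u ^ 2 * w u v - 2 * (w u v * (x u * x v)) + x v ^ 2 ≥ 0 := by
      linarith [sq_nonneg (w u v * x u - x v)]
    have := mul_le_mul_of_nonneg_right (hw u v huv) (sq_nonneg (x v))
    refine le_of_mul_le_mul_left ?_ hpos
    linarith
  have hswap : ∑ u, ∑ v ∈ G.neighborFinset u, w v u * x v ^ 2 =
      ∑ u, ∑ v ∈ G.neighborFinset u, w u v * x u ^ 2 :=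
    sum_comm' (by simp [adj_comm])
  calc adjForm G x = ∑ u, ∑ v ∈ G.neighborFinset u, x u * x v := by
        simp only [adjForm_eq_sum, neighborFinset_eq_filter, sum_filter]
        congr!
    _ ≤ ∑ u, ∑ v ∈ G.neighborFinset u, (w u v * x u ^ 2 + w v u * x v ^ 2) / 2 := by
        gcongr with u _ v hv
        exact hamgm u v ((G.mem_neighborFinset u v).1 hv)
    _ = ∑ u, (∑ v ∈ G.neighborFinset u, w u v) * x u ^ 2 := by
        simp only [← sum_div, sum_add_distrib, hswap, add_self_div_two, sum_mul]
    _ ≤ ∑ u, B * x u ^ 2 := by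
        gcongr with u
        exact hB u
    _ = B * (x ⬝ᵥ x) := by simp only [← mul_sum, dotProduct, sq]

lemma rho_le_of_forall_degree_le [Nonempty V] [DecidableRel G.Adj] {d : ℕ}
    (h : ∀ v, G.degree v ≤ d) : rho G ≤ d :=
  rho_le_of_weights (w := fun _ _ => 1) (fun _ _ => zero_le_one) (by simp) (by simpa using h)

end SpectralRadius

section Orientation

/-- `r` is an orientation of `G`, used to record that `G` is sparse through bounds on the
outdegrees `#{v | r u v}`. An edge may be directed both ways. -/
def Orients (r : V → V → Prop) (G : SimpleGraph V) : Prop :=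
  ∀ u v, G.Adj u v ↔ r u v ∨ r v u

variable [Fintype V] {r : V → V → Prop} [DecidableRel r]

lemma Orients.rho_le [Nonempty V] (hr : Orients r G) {a B : ℝ} (ha : 0 < a)
    (hB : ∀ u, a * #{v | r u v} + a⁻¹ * #{v | r v u} ≤ B) : rho G ≤ B := by
  classical
  have ha' : 0 < a⁻¹ := inv_pos.2 ha
  refine rho_le_of_weights
    (w := fun u v => (if r u v then a else 0) + if r v u then a⁻¹ else 0) ?_ ?_ fun u => ?_
  · intro u v
    positivity
  · intro u v huv
    rcases (hr u v).1 huv with h | h <;> simp only [h, if_true] <;> split_ifs <;>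
      nlinarith [mul_inv_cancel₀ ha.ne']
  · calc _ ≤ ∑ v, ((if r u v then a else 0) + if r v u then a⁻¹ else 0) :=
          sum_le_univ_sum_of_nonneg fun v => by positivity
      _ = a * #{v | r u v} + a⁻¹ * #{v | r v u} := by
          simp [sum_add_distrib, ← sum_filter, mul_comm]
      _ ≤ B := hB u

lemma Orients.sum_degree_le [DecidableRel G.Adj] (hr : Orients r G) {d : ℕ}
    (hd : ∀ u, #{v | r u v} ≤ d) : ∑ v, G.degree v ≤ 2 * d * Fintype.card V := by
  classical
  have hout : ∑ u, #{v | r u v} ≤ d * Fintype.card V := by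
    simpa [mul_comm] using sum_le_card_nsmul univ _ d fun u _ => hd u
  have hin : ∑ u, #{v | r v u} = ∑ u, #{v | r u v} :=
    (sum_card_bipartiteAbove_eq_sum_card_bipartiteBelow r).symm
  calc ∑ u, G.degree u ≤ ∑ u, (#{v | r u v} + #{v | r v u}) := by
        gcongr with u
        rw [← card_neighborFinset_eq_degree, neighborFinset_eq_filter,
          filter_congr fun v _ => hr u v, filter_or]
        exact card_union_le _ _
    _ ≤ 2 * d * Fintype.card V := by
        rw [sum_add_distrib, hin]
        linarith

lemma Orients.rho_le_of_degree_le [Nonempty V] [DecidableRel G.Adj] (hr : Orients r G) {d : ℕ}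
    {D e : ℝ} (hd : ∀ u, #{v | r u v} ≤ d) (hD : ∀ u, (G.degree u : ℝ) ≤ e ^ 2 * D)
    (he : 0 < e) (hD₀ : 0 < D) : rho G ≤ (d + 1) * e * √D := by
  refine hr.rho_le (a := e * √D) (by positivity) fun u => ?_
  have hout : (#{v | r u v} : ℝ) ≤ d := Nat.cast_le.2 (hd u)
  have hin : (#{v | r v u} : ℝ) ≤ e ^ 2 * D := by
    refine le_trans (Nat.cast_le.2 ?_) (hD u)
    rw [← card_neighborFinset_eq_degree, neighborFinset_eq_filter]
    gcongr with v
    exact fun h => (hr u v).2 (.inr h)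
  calc e * √D * #{v | r u v} + (e * √D)⁻¹ * #{v | r v u}
      ≤ e * √D * d + (e * √D)⁻¹ * (e ^ 2 * D) := by gcongr
    _ = (d + 1) * e * √D := by
        field_simp
        rw [Real.sq_sqrt hD₀.le]
        ring

lemma rho_between_le [Nonempty V] [DecidableRel G.Adj] {s t : Finset V} (hst : Disjoint s t)
    {b : ℝ} (hb : 0 < b) (h : ∀ w ∈ t, (#{v ∈ s | G.Adj w v} : ℝ) ≤ b ^ 2) :
    rho (G.between s t) ≤ b * √(Fintype.card V) := by
  classical
  set n : ℝ := (Fintype.card V : ℝ)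
  have hn : 0 < n := Nat.cast_pos.2 Fintype.card_pos
  let r (w v : V) : Prop := w ∈ t ∧ v ∈ s ∧ G.Adj w v
  have hr : Orients r (G.between s t) := fun u v => by
    simp only [between_adj, mem_coe, r, G.adj_comm v u]
    tauto
  refine hr.rho_le (a := √n / b) (by positivity) fun u => ?_
  by_cases hu : u ∈ t
  · have hin : #{v | r v u} = 0 := by
      simp [r, disjoint_right.1 hst hu]
    have hout : (#{v | r u v} : ℝ) ≤ b ^ 2 := by
      simpa [r, hu, filter_and, inter_filter] using h u hu
    calc √n / b * #{v | r u v} + (√n / b)⁻¹ * #{v | r v u} ≤ √n / b * b ^ 2 := by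
          rw [hin, Nat.cast_zero, mul_zero, add_zero]
          gcongr
      _ = b * √n := by field_simp
  · have hout : #{v | r u v} = 0 := by simp [r, hu]
    have hin : (#{v | r v u} : ℝ) ≤ n := Nat.cast_le.2 (card_le_univ _)
    calc √n / b * #{v | r u v} + (√n / b)⁻¹ * #{v | r v u} ≤ (√n / b)⁻¹ * n := by
          rw [hout, Nat.cast_zero, mul_zero, zero_add]
          gcongr
      _ = b * √n := by
          field_simp
          rw [Real.sq_sqrt hn.le]

open Classical in
lemma exists_orients_of_forall_exists_card_le {d : ℕ}
    (h : ∀ s : Finset V, s.Nonempty → ∃ v ∈ s, #{u ∈ s | G.Adj v u} ≤ d) :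
    ∃ r : V → V → Prop, Orients r G ∧ ∀ u, #{v | r u v} ≤ d := by
  suffices ∀ s : Finset V, ∃ r, Orients r (G.between s s) ∧ ∀ u, #{v | r u v} ≤ d by
    obtain ⟨r, hr, hd⟩ := this univ
    exact ⟨r, by simpa [Orients, between_adj] using hr, hd⟩
  intro s
  induction s using Finset.strongInduction with
  | H s ih =>
    rcases s.eq_empty_or_nonempty with rfl | hs
    · exact ⟨fun _ _ => False, by simp [Orients, between_adj], by simp⟩
    obtain ⟨v, hvs, hvd⟩ := h s hs
    obtain ⟨r, hr, hd⟩ := ih _ (erase_ssubset hvs)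
    simp only [Orients, between_adj, coe_erase, Set.mem_sdiff, mem_coe, Set.mem_singleton_iff,
      or_self] at hr
    have hrv (w : V) : ¬ r v w := fun hvw => by
      have := (hr v w).2 (.inl hvw)
      tauto
    refine ⟨fun u w => r u w ∨ u = v ∧ w ∈ s ∧ G.Adj v w, fun u w => ?_, fun u => ?_⟩
    · simp only [between_adj, mem_coe, or_self]
      by_cases hu : u = v <;> by_cases hw : w = v <;>
        grind [G.adj_comm, G.loopless]
    · by_cases hu : u = v
      · simpa [hu, hrv, filter_and, inter_filter] using hvd
      · simpa [hu] using hd u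

end Orientation

section Subgraphs

lemma isContained_of_copy_induce_compl_singleton {a : W} (ψ : Copy (F.induce {a}ᶜ) G) {y : V}
    (hy : y ∉ Set.range ψ) (h : ∀ u (hu : F.Adj a u), G.Adj y (ψ ⟨u, hu.ne'⟩)) : F ⊑ G := by
  classical
  let φ (w : W) : V := if hw : w = a then y else ψ ⟨w, hw⟩
  have hφa : φ a = y := dif_pos rfl
  have hφ {w : W} (hw : w ≠ a) : φ w = ψ ⟨w, hw⟩ := dif_neg hw
  have hφy {w : W} (hw : w ≠ a) : φ w ≠ y := fun hwy => hy ⟨_, (hφ hw).symm.trans hwy⟩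
  refine isContained_iff_exists_le_comap.2 ⟨⟨φ, fun u v huv => ?_⟩, fun u v huv => ?_⟩
  · rcases eq_or_ne u a with hu | hu <;> rcases eq_or_ne v a with hv | hv
    · exact hu.trans hv.symm
    · exact absurd (huv.symm.trans (hu ▸ hφa)) (hφy hv)
    · exact absurd (huv.trans (hv ▸ hφa)) (hφy hu)
    · exact congrArg Subtype.val (ψ.toEmbedding.injective ((hφ hu).symm.trans (huv.trans (hφ hv))))
  · change G.Adj (φ u) (φ v)
    rcases eq_or_ne u a with hu | hu <;> rcases eq_or_ne v a with hv | hv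
    · exact absurd (hu.trans hv.symm) huv.ne
    · subst hu
      rw [hφa, hφ hv]
      exact h v huv
    · subst hv
      rw [hφa, hφ hu]
      exact (h u huv.symm).symm
    · rw [hφ hu, hφ hv]
      exact ψ.toHom.map_adj (induce_adj.2 huv)

lemma isContained_of_forall_card_le_degree_add_one [Fintype V] [DecidableRel G.Adj] [Nonempty V]
    [Fintype W] (hF : F.IsTree) (h : ∀ v, Fintype.card W ≤ G.degree v + 1) : F ⊑ G := by
  classical
  induction hn : Fintype.card W generalizing W with
  | zero =>
    have := hF.connected.nonempty
    exact absurd hn Fintype.card_ne_zero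
  | succ n ih =>
    rcases subsingleton_or_nontrivial W with hW | hW
    · obtain ⟨v⟩ := ‹Nonempty V›
      exact isContained_iff_exists_le_comap.2 ⟨⟨fun _ => v, Function.injective_of_subsingleton _⟩,
        fun _ _ huv => absurd (Subsingleton.elim _ _) huv.ne⟩
    obtain ⟨leaf, hleaf⟩ := hF.exists_vert_degree_one_of_nontrivial
    obtain ⟨u, hu, huniq⟩ := degree_eq_one_iff_existsUnique_adj.1 hleaf
    have hcard : Fintype.card ({leaf}ᶜ : Set W) = n := by
      rw [Fintype.card_compl_set, hn, Set.card_singleton, Nat.add_sub_cancel]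
    have hT : (F.induce {leaf}ᶜ).IsTree :=
      ⟨hF.connected.induce_compl_singleton_of_degree_eq_one hleaf, hF.isAcyclic.induce _⟩
    obtain ⟨ψ⟩ := ih hT (fun v => by have := h v; omega) hcard
    have hn₀ : 0 < n := hcard ▸ Fintype.card_pos_iff.2 ⟨⟨u, hu.ne'⟩⟩
    set x := ψ ⟨u, hu.ne'⟩
    have hx : x ∈ univ.map ψ.toEmbedding := mem_map_of_mem ψ.toEmbedding (mem_univ _)
    have hlt : #((univ.map ψ.toEmbedding).erase x) < #(G.neighborFinset x) := by
      rw [card_erase_of_mem hx, card_map, card_univ, hcard, card_neighborFinset_eq_degree]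
      have := h x
      omega
    obtain ⟨y, hy, hyψ⟩ := exists_mem_notMem_of_card_lt_card hlt
    rw [mem_neighborFinset] at hy
    refine isContained_of_copy_induce_compl_singleton ψ (y := y) ?_ fun w hw => ?_
    · rintro ⟨w, rfl⟩
      exact hyψ (mem_erase.2 ⟨hy.ne', mem_map_of_mem ψ.toEmbedding (mem_univ w)⟩)
    · obtain rfl := huniq w hw
      exact hy.symm

open Classical in
lemma exists_orients_of_isTree_of_free [Fintype V] [Fintype W] (hF : F.IsTree) (hG : F.Free G) :
    ∃ r : V → V → Prop, Orients r G ∧ ∀ u, #{v | r u v} ≤ Fintype.card W := by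
  refine exists_orients_of_forall_exists_card_le fun s hs => ?_
  by_contra! hdeg
  have : Nonempty s := hs.to_subtype
  have hdegree (v : s) : (G.induce (s : Set V)).degree v = #{u ∈ s | G.Adj v u} := by
    rw [← card_neighborFinset_eq_degree, ← card_map (.subtype (· ∈ s))]
    congr 1
    ext u
    simp [and_comm]
  refine hG (IsContained.trans ?_ (Copy.induce G s).isContained)
  refine isContained_of_forall_card_le_degree_add_one hF fun v => ?_
  rw [hdegree]
  exact (hdeg v v.2).le.trans (Nat.le_succ _)

lemma card_filter_le_of_completeBipartiteGraph_free [Fintype V] [DecidableRel G.Adj] {k t : ℕ}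
    (hG : (completeBipartiteGraph (Fin k) (Fin t)).Free G) (s : Finset V) :
    #{w | k ≤ #{v ∈ s | G.Adj w v}} ≤ (#s).choose k * t := by
  classical
  have hcommon (A : Finset V) (hA : A ∈ s.powersetCard k) : #{w | ∀ v ∈ A, G.Adj w v} ≤ t := by
    by_contra! hlt
    obtain ⟨B, hB, hBcard⟩ := exists_subset_card_eq hlt.le
    refine hG (completeBipartiteGraph_isContained_iff.2 ⟨A, B, ?_, ?_, ?_⟩)
    · rw [Fintype.card_fin, (mem_powersetCard.1 hA).2]
    · rw [Fintype.card_fin, hBcard]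
    · exact fun v hv w hw => ((mem_filter.1 (hB hw)).2 v hv).symm
  rw [← card_powersetCard]
  refine le_trans (card_le_card fun w hw => ?_) (card_biUnion_le_card_mul _ _ t hcommon)
  obtain ⟨A, hA, hAcard⟩ := exists_subset_card_eq (mem_filter.1 hw).2
  refine mem_biUnion.2 ⟨A, mem_powersetCard.2 ⟨hA.trans (filter_subset _ _), hAcard⟩, ?_⟩
  exact mem_filter.2 ⟨mem_univ w, fun v hv => (mem_filter.1 (hA hv)).2⟩

lemma isContained_completeBipartiteGraph {α β : Type*} [Fintype W] [Fintype α] [Fintype β]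
    {p : W → Prop} [DecidablePred p] (hp : ∀ u v, F.Adj u v → (p u ↔ ¬ p v))
    (hα : #{v | p v} ≤ Fintype.card α) (hβ : #{v | ¬ p v} ≤ Fintype.card β) :
    F ⊑ completeBipartiteGraph α β := by
  rw [← Fintype.card_subtype] at hα hβ
  obtain ⟨f⟩ := Function.Embedding.nonempty_of_card_le hα
  obtain ⟨g⟩ := Function.Embedding.nonempty_of_card_le hβ
  refine isContained_iff_exists_le_comap.2
    ⟨(Equiv.sumCompl p).symm.toEmbedding.trans (f.sumMap g), fun u v huv => ?_⟩
  have := hp u v huv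
  by_cases hv : p v
  · have hu : ¬ p u := by tauto
    simp [hu, hv]
  · have hu : p u := by tauto
    simp [hu, hv]

end Subgraphs

section AsymptoticBound

lemma le_between_sup_between_sup_between (G : SimpleGraph V) (s t : Set V) :
    G ≤ G.between s (s ∪ t)ᶜ ⊔ (G.between (s ∪ t) (s ∪ t) ⊔ G.between sᶜ sᶜ) := by
  intro u v huv
  simp only [sup_adj, between_adj, Set.mem_compl_iff, Set.mem_union]
  tauto

lemma rho_between_self_le [Fintype V] [Nonempty V] (G : SimpleGraph V) (s : Finset V) :
    rho (G.between s s) ≤ #s := by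
  classical
  refine rho_le_of_forall_degree_le fun v => card_le_card fun u hu => ?_
  rw [mem_neighborFinset, between_adj, mem_coe] at hu
  tauto

variable [Fintype V] {r : V → V → Prop} [DecidableRel r] {d k t : ℕ}

lemma Orients.card_filter_lt_degree_le [Nonempty V] [DecidableRel G.Adj] (hr : Orients r G)
    (hd : ∀ u, #{v | r u v} ≤ d) {c : ℝ} (hc : 0 < c) :
    #{v | c * Fintype.card V < G.degree v} ≤ ⌊2 * d / c⌋₊ := by
  have hn : (0 : ℝ) < Fintype.card V := Nat.cast_pos.2 Fintype.card_pos
  set s : Finset V := {v | c * Fintype.card V < G.degree v}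
  rw [Nat.le_floor_iff (by positivity), le_div_iff₀ hc]
  refine le_of_mul_le_mul_right ?_ hn
  calc (#s : ℝ) * c * Fintype.card V = ∑ _ ∈ s, c * Fintype.card V := by
        rw [sum_const, nsmul_eq_mul, mul_assoc]
    _ ≤ ∑ v ∈ s, (G.degree v : ℝ) := sum_le_sum fun v hv => (mem_filter.1 hv).2.le
    _ ≤ ∑ v, (G.degree v : ℝ) := sum_le_univ_sum_of_nonneg fun v => Nat.cast_nonneg _
    _ ≤ 2 * d * Fintype.card V := mod_cast hr.sum_degree_le hd

lemma Orients.rho_between_le_of_degree_le [Nonempty V] [DecidableRel G.Adj] (hr : Orients r G)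
    (hd : ∀ u, #{v | r u v} ≤ d) {s : Set V} {D e : ℝ}
    (hD : ∀ v ∈ s, (G.degree v : ℝ) ≤ e ^ 2 * D) (he : 0 < e) (hD₀ : 0 < D) :
    rho (G.between s s) ≤ (d + 1) * e * √D := by
  classical
  have hr' : Orients (fun u v => r u v ∧ u ∈ s ∧ v ∈ s) (G.between s s) := by
    intro u v
    simp only [between_adj, hr u v]
    tauto
  refine hr'.rho_le_of_degree_le (fun u => ?_) (fun u => ?_) he hD₀
  · exact (card_le_card (monotone_filter_right univ fun v _ hv => hv.1)).trans (hd u)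
  · by_cases hu : u ∈ s
    · exact (Nat.cast_le.2 (degree_le_of_le between_le)).trans (hD u hu)
    · have hdegree : (G.between s s).degree u = 0 := by
        rw [degree_eq_zero]
        intro v
        simp [between_adj, hu]
      rw [hdegree, Nat.cast_zero]
      positivity

lemma Orients.rho_le_of_completeBipartiteGraph_free [Nonempty V] (hr : Orients r G)
    (hd : ∀ u, #{v | r u v} ≤ d) (hG : (completeBipartiteGraph (Fin k) (Fin t)).Free G)
    {b e : ℝ} (hb : 0 < b) (hkb : k ≤ b ^ 2 + 1) (he : 0 < e) :
    rho G ≤ (⌊2 * d / e ^ 2⌋₊ + ⌊2 * d / e ^ 2⌋₊.choose k * t : ℕ) +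
      (b + (d + 1) * e) * √(Fintype.card V) := by
  classical
  set M := ⌊2 * d / e ^ 2⌋₊
  let L : Finset V := {v | e ^ 2 * Fintype.card V < G.degree v}
  let B : Finset V := {w | k ≤ #{v ∈ L | G.Adj w v}}
  have hL : #L ≤ M := hr.card_filter_lt_degree_le hd (by positivity)
  have hB : #B ≤ M.choose k * t :=
    (card_filter_le_of_completeBipartiteGraph_free hG L).trans
      (Nat.mul_le_mul_right t (Nat.choose_le_choose k hL))
  have hcross : rho (G.between L (L ∪ B : Finset V)ᶜ) ≤ b * √(Fintype.card V) := by
    rw [← coe_compl]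
    refine rho_between_le (disjoint_compl_right.mono_left subset_union_left) hb fun w hw => ?_
    have hwB : #{v ∈ L | G.Adj w v} + 1 ≤ k := by simp_all [B]
    have : (#{v ∈ L | G.Adj w v} : ℝ) + 1 ≤ k := mod_cast hwB
    linarith
  have hcore : rho (G.between (L ∪ B : Finset V) (L ∪ B : Finset V)) ≤ (M + M.choose k * t : ℕ) :=
    (rho_between_self_le G _).trans
      (Nat.cast_le.2 ((card_union_le L B).trans (add_le_add hL hB)))
  have hsparse : rho (G.between (L : Set V)ᶜ (L : Set V)ᶜ) ≤ (d + 1) * e * √(Fintype.card V) :=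
    hr.rho_between_le_of_degree_le hd (fun v hv => by simpa [L] using hv) he
      (Nat.cast_pos.2 Fintype.card_pos)
  rw [coe_union] at hcross hcore
  have hsplit := rho_le_add_of_le_sup (le_between_sup_between_sup_between G L B)
  have hsup := rho_le_add_of_le_sup
    (le_refl (G.between (L ∪ B : Set V) (L ∪ B : Set V) ⊔ G.between (L : Set V)ᶜ (L : Set V)ᶜ))
  linarith

lemma eventually_add_mul_sqrt_lt {β : ℝ} (hβ : β < √k) (C : ℝ) :
    ∀ᶠ n : ℕ in Filter.atTop, C + β * √n < √(k * (n - k)) := by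
  have hlim : Filter.Tendsto (fun n : ℕ => (√k - β) * √n) Filter.atTop Filter.atTop :=
    (Real.tendsto_sqrt_atTop.comp tendsto_natCast_atTop_atTop).const_mul_atTop (sub_pos.2 hβ)
  filter_upwards [hlim.eventually_gt_atTop (C + k), Filter.eventually_ge_atTop k] with n hn hkn
  have hsqrt : √k * √n ≤ √(k * (n - k)) + k := by
    rw [← sub_le_iff_le_add]
    refine Real.le_sqrt_of_sq_le ?_
    have hkn' : (k : ℝ) ≤ √k * √n := by
      calc (k : ℝ) = √k * √k := (Real.mul_self_sqrt (Nat.cast_nonneg k)).symm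
        _ ≤ √k * √n := by gcongr
    calc (√k * √n - k) ^ 2 = √k ^ 2 * √n ^ 2 - k * (2 * (√k * √n) - k) := by ring
      _ ≤ √k ^ 2 * √n ^ 2 - k * k := by
          gcongr
          linarith
      _ = k * (n - k) := by
          rw [Real.sq_sqrt (Nat.cast_nonneg k), Real.sq_sqrt (Nat.cast_nonneg n)]
          ring
  linarith

end AsymptoticBound

section Trees

variable [Finite W] {k t : ℕ}

lemma exists_lt_sqrt_forall_rho_le (hF : F.IsTree) (hk : 0 < k)
    (hFK : F ⊑ completeBipartiteGraph (Fin k) (Fin t)) :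
    ∃ C β : ℝ, β < √k ∧ ∀ (V : Type*) [Fintype V] [Nonempty V] (G : SimpleGraph V),
      F.Free G → rho G ≤ C + β * √(Fintype.card V) := by
  classical
  have := Fintype.ofFinite W
  have hk₁ : (1 : ℝ) ≤ k := Nat.one_le_cast.2 hk
  set d := Fintype.card W
  -- Any `b > 0` with `k - 1 ≤ b ^ 2 < k` would do; for `k = 1` this excludes `√(k - 1)`.
  set b : ℝ := √(k - 1 / 2) with hb
  have hb₀ : 0 < b := Real.sqrt_pos.2 (by linarith)
  have hkb : (k : ℝ) ≤ b ^ 2 + 1 := by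
    rw [hb, Real.sq_sqrt (by linarith)]
    linarith
  have hbk : b < √k := Real.sqrt_lt_sqrt (by linarith) (by linarith)
  set e : ℝ := (√k - b) / (2 * (d + 1))
  have he : 0 < e := div_pos (sub_pos.2 hbk) (by positivity)
  have hβ : b + (d + 1) * e < √k := by
    have : (d + 1) * e = (√k - b) / 2 := by
      simp only [e]
      field_simp
    linarith
  set M := ⌊2 * d / e ^ 2⌋₊
  refine ⟨(M + M.choose k * t : ℕ), b + (d + 1) * e, hβ, fun V _ _ G hG => ?_⟩
  obtain ⟨r, hr, hd⟩ := exists_orients_of_isTree_of_free hF hG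
  exact hr.rho_le_of_completeBipartiteGraph_free hd (fun h => hG (hFK.trans h)) hb₀ hkb he

theorem exists_forall_isContained_of_rho_splitGraph_le (hF : F.IsTree) (hk : 0 < k)
    (hFK : F ⊑ completeBipartiteGraph (Fin k) (Fin t)) :
    ∃ N : ℕ, ∀ n : ℕ, N ≤ n → ∀ (V : Type*) [Fintype V] (G : SimpleGraph V),
      Fintype.card V = n → rho (splitGraph n k) ≤ rho G → F ⊑ G := by
  obtain ⟨C, β, hβ, hC⟩ := exists_lt_sqrt_forall_rho_le hF hk hFK
  obtain ⟨N, hN⟩ := Filter.eventually_atTop.1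
    ((eventually_add_mul_sqrt_lt hβ C).and (Filter.eventually_gt_atTop k))
  refine ⟨N, fun n hn V _ G hV hrho => by_contra fun hG => ?_⟩
  obtain ⟨hlt, hkn⟩ := hN n hn
  have : Nonempty V := Fintype.card_pos_iff.1 (hV ▸ hk.trans hkn)
  have hle := hC V G hG
  rw [hV] at hle
  exact ((sqrt_mul_le_rho_splitGraph hk hkn).trans (hrho.trans hle)).not_gt hlt

end Trees

section Spiders

lemma length_path_eq_dist (hF : F.IsAcyclic) {u v : W} (p : F.Path u v) :
    (p : F.Walk u v).length = F.dist u v := by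
  obtain ⟨q, hq, hlen⟩ := (p : F.Walk u v).reachable.exists_path_of_dist
  have := hF.subsingleton_path u v
  rw [← hlen, Subsingleton.elim p ⟨q, hq⟩]

lemma odd_dist_iff_even_dist_of_adj (hF : F.IsTree) (c : W) {u v : W} (huv : F.Adj u v) :
    Odd (F.dist c u) ↔ Even (F.dist c v) := by
  rcases hF.dist_eq_dist_add_one_of_adj c huv with h | h <;>
    simp only [h, Nat.odd_add_one, Nat.even_add_one, Nat.not_odd_iff_even, Nat.not_even_iff_odd]

variable [Fintype W] [DecidableRel F.Adj]

lemma sum_degree_odd_dist_add_one (hF : F.IsTree) (c : W) :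
    ∑ v with Odd (F.dist c v), F.degree v + 1 = Fintype.card W := by
  classical
  have hbip : F.IsBipartiteWith ({v | Odd (F.dist c v)} : Finset W)
      ({v | Even (F.dist c v)} : Finset W) := by
    refine ⟨disjoint_coe.2 (disjoint_filter.2 fun v _ => Nat.not_even_iff_odd.2), fun u v huv => ?_⟩
    have hparity := odd_dist_iff_even_dist_of_adj hF c huv
    simp only [coe_filter, mem_univ, true_and, Set.mem_ofPred_eq, ← Nat.not_even_iff_odd]
      at hparity ⊢
    tauto
  rw [isBipartiteWith_sum_degrees_eq_card_edges hbip, hF.card_edgeFinset]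

lemma IsCenter.degree_le_two {c v : W} (hF : IsSpider F) (hc : IsCenter F c) (hvc : v ≠ c) :
    F.degree v ≤ 2 := by
  rcases hc with hc | ⟨h, -⟩
  · by_contra! hv
    exact hvc (hF.branch_unique v c hv hc)
  · exact h v

lemma numOddLegs_le_card_filter (hF : F.IsAcyclic) (c : W) :
    numOddLegs F c ≤ #{v | Odd (F.dist c v) ∧ F.degree v = 1} := by
  rw [numOddLegs, ← Set.ncard_coe_finset]
  refine Set.ncard_le_ncard_of_injOn Sigma.fst ?_ ?_ (finite_toSet _)
  · rintro ⟨v, p⟩ ⟨hleaf, hodd⟩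
    rw [length_path_eq_dist hF] at hodd
    exact mem_coe.2 (mem_filter.2 ⟨mem_univ v, hodd, hleaf⟩)
  · rintro ⟨v, p⟩ - ⟨w, q⟩ - (rfl : v = w)
    have := hF.subsingleton_path c v
    rw [Subsingleton.elim p q]

lemma IsSpider.card_add_numOddLegs_le {c : W} (hF : IsSpider F) (hc : IsCenter F c) :
    Fintype.card W + numOddLegs F c ≤ 2 * #{v | Odd (F.dist c v)} + 1 := by
  have hdeg (v : W) (hv : v ∈ ({v | Odd (F.dist c v)} : Finset W)) :
      F.degree v + (if F.degree v = 1 then 1 else 0) ≤ 2 := by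
    have hvc : v ≠ c := by
      rintro rfl
      simp at hv
    have hle := hc.degree_le_two hF hvc
    split_ifs <;> omega
  have hsum := sum_le_card_nsmul _ _ 2 hdeg
  rw [sum_add_distrib, ← card_filter, filter_filter, smul_eq_mul] at hsum
  have hlegs := numOddLegs_le_card_filter hF.isTree.isAcyclic c
  have hedges := sum_degree_odd_dist_add_one hF.isTree c
  omega

lemma IsSpider.card_even_dist_le {c : W} {k : ℕ} (hF : IsSpider F) (hc : IsCenter F c)
    (h : Fintype.card W ≤ 2 * k + numOddLegs F c) : #{v | Even (F.dist c v)} ≤ k := by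
  have hodd := hF.card_add_numOddLegs_le hc
  have hadd := card_filter_add_card_filter_not (s := univ) fun v => Even (F.dist c v)
  simp only [Nat.not_even_iff_odd, card_univ] at hadd
  omega

end Spiders

end SpiderSpectral

theorem corollary1p1_general {W : Type*} [Fintype W] (F : SimpleGraph W) [DecidableRel F.Adj]
    (k : ℕ) (hF : SpiderSpectral.IsSpider F) (c : W) (hc : SpiderSpectral.IsCenter F c)
    (hcard : Fintype.card W ≤ 2 * k + SpiderSpectral.numOddLegs F c) :
    ∃ N : ℕ, ∀ n : ℕ, N ≤ n → ∀ (V : Type*) [Fintype V] (G : SimpleGraph V),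
      Fintype.card V = n →
      SpiderSpectral.rho (SpiderSpectral.splitGraph n k) ≤ SpiderSpectral.rho G →
      F.IsContained G := by
  have heven := hF.card_even_dist_le hc hcard
  have hk : 0 < k := (Finset.card_pos.2 ⟨c, by simp⟩).trans_le heven
  refine SpiderSpectral.exists_forall_isContained_of_rho_splitGraph_le hF.isTree hk
    (t := Fintype.card W) (SpiderSpectral.isContained_completeBipartiteGraph
      (p := fun v => Even (F.dist c v)) (fun u v huv => ?_) ?_ ?_)
  · rw [Nat.not_even_iff_odd, SpiderSpectral.odd_dist_iff_even_dist_of_adj hF.isTree c huv.symm]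
  · rwa [Fintype.card_fin]
  · rw [Fintype.card_fin]
    exact Finset.card_le_univ _

theorem corollary1p1 {W : Type*} [Fintype W] (F : SimpleGraph W) [DecidableRel F.Adj]
    (k r s : ℕ) (hk : 2 ≤ k)
    (hF : SpiderSpectral.IsSpider F) (hcard : Fintype.card W = 2 * k + 3)
    (c : W) (hc : SpiderSpectral.IsCenter F c)
    (hr : SpiderSpectral.numOddLegs F c = r) (hs : SpiderSpectral.numUnitLegs F c = s)
    (hr3 : 3 ≤ r) (hrs : (2 : ℤ) ≤ 2 * (s : ℤ) - (r : ℤ)) :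
    ∃ N : ℕ, ∀ n : ℕ, N ≤ n → ∀ (V : Type*) [Fintype V] (G : SimpleGraph V),
      Fintype.card V = n →
      SpiderSpectral.rho (SpiderSpectral.splitGraph n k) ≤ SpiderSpectral.rho G →
      F.IsContained G :=
  corollary1p1_general F k hF c hc (by omega)
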